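/- Let $(\Omega,\lambda)$ be an atomless probability space (every measurable set of positive measure contains a measurable subset of strictly smaller positive measure). For $n\ge 0$ let $[n]=\{0,\dots,n\}$, let $\Delta_n=\{(x_0,\dots,x_n)\in[0,1]^{n+1} : \sum_i x_i=1\}$, and let $\triangledown_n=L^1(\Omega,[n])$ be the space of random variables $\Omega\to[n]$ up to almost sure equality, with the metric $d(f,g)=\lambda(\{f\neq g\})$. The probability-law map is $p_n:\triangledown_n\to\Delta_n$, $p_n(f)=(\lambda(f^{-1}(i)))_{0\le i\le n}$. An injective increasing map $s:[m]\to[n]$ (a face map) induces $\Delta(s):\Delta_m\to\Delta_n$, $\Delta(s)(x)_i=\sum_{s(j)=i}x_j$, and $\triangledown(s):\triangledown_m\to\triangledown_n$, $f\mapsto s\circ f$. A pre-simplicial (semi-simplicial) set $F$ is a contravariant functor to sets from the category of the $[n]$, $n\ge0$, and face maps; write $F_n=F([n])$ and $x s=F(s)(x)$. Its realization $\|F\|$ is the quotient of $\bigsqcup_n F_n\times\Delta_n$ ($F_n$ discrete) by the equivalence relation generated by $(x s,a)\sim(x,\Delta(s)(a))$, and $\mathbb L(F)$ is the quotient of $\bigsqcup_n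 F_n\times\triangledown_n$ by the equivalence relation generated by $(x s,f)\sim(x,\triangledown(s)(f))$, for all face maps $s$; both carry the quotient topology. Let $p_F:\mathbb L(F)\to\|F\|$, $[x,f]\mapsto[x,p_n(f)]$. An exhaustion map is a continuous map $t\mapsto\Omega_t$ from $[0,1]$ to the measure algebra of $\Omega$ (measurable sets modulo null sets, with distance $\lambda(A\,\triangle\,B)$) that is increasing and satisfies $\lambda(\Omega_t)=t$. **Theorem.** For every pre-simplicial set $F$ the probability-law map $p_F:\mathbb L(F)\to\|F\|$ is a homotopy equivalence; in particular $\mathbb L(F)$ has the homotopy type of a CW-complex. More explicitly, exhaustion maps exist, and for every exhaustion map $(\Omega_t)$ there are continuous maps $\sigma_n:\Delta_n\to\triangledown_n$ and $H_n:[0,1]\times\triangledown_n\to\triangledown_n$ ($n\ge0$) such that: 1. for all $\alpha\in\Delta_n$ and $k\in[n]$, $\sigma_n(\alpha)=k$ almost everywhere on $\Omega_{\alpha_0+\dots+\alpha_k}\setminus\Omega_{\alpha_0+\dots+\alpha_{k-1}}$; moreover $p_n\circ\sigma_n=\mathrm{id}$, and $\sigma_n\circ\Delta(s)=\triangledown(s)\circ\sigma_m$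 for every face map $s:[m]\to[n]$; 2. $H_n$ is a homotopy from $\sigma_n\circ p_n$ to the identity, and $H_n(u,\triangledown(s)(f))=\triangledown(s)(H_m(u,f))$ for every face map $s:[m]\to[n]$, $u\in[0,1]$, $f\in\triangledown_m$; 3. $p_n(H_n(u,f))=p_n(f)$ and $H_n(u,\sigma_n(\alpha))=\sigma_n(\alpha)$ for all $u\in[0,1]$, $f\in\triangledown_n$, $\alpha\in\Delta_n$; 4. for every pre-simplicial set $F$, the formulas $\sigma_F[x,\alpha]=[x,\sigma_n(\alpha)]$ and $H_F(u,[x,f])=[x,H_n(u,f)]$ define continuous maps $\sigma_F:\|F\|\to\mathbb L(F)$ and $H_F:[0,1]\times\mathbb L(F)\to\mathbb L(F)$ such that $p_F\circ\sigma_F=\mathrm{id}$ and $H_F$ is a homotopy from $\sigma_F\circ p_F$ to the identity. -/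

import Mathlib

open MeasureTheory CategoryTheory Simplicial Opposite
open scoped ContinuousMap

noncomputable section

namespace RandomizedSimplicial

universe u v w

/-! ### Pre-simplicial sets and realizations -/

/-- A pre-simplicial set (semi-simplicial set): a presheaf of sets on the category of the finite
ordinals `[n] = {0, …, n}` and injective increasing maps. -/
abbrev PreSimplicialSet := SemiSimplexCategoryᵒᵖ ⥤ Type u

/-- The set `F_n` of `n`-simplices. -/
abbrev PreSimplicialSet.simplices (F : PreSimplicialSet.{u}) (n : ℕ) : Type u :=
  F.obj (op ⦋n⦌ₛ)

section Realization

variable (F : PreSimplicialSet.{u})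
  (X : ℕ → Type v) (dX : ∀ m n : ℕ, (Fin (m + 1) ↪o Fin (n + 1)) → X m → X n)
  (Y : ℕ → Type w) (dY : ∀ m n : ℕ, (Fin (m + 1) ↪o Fin (n + 1)) → Y m → Y n)

/-- The disjoint union `∐_n F_n × X_n`, with `F_n` discrete: it is written as the disjoint union,
over all simplices `α` of all dimensions `n`, of a copy of `X_n`. -/
abbrev PreRealization : Type (max u v) :=
  Σ α : (Σ n, F.simplices n), X α.1

/-- The relation `(α s, a) ∼ (α, s_* a)`, for `s : [m] → [n]` a face map, `α ∈ F_n`, `a ∈ X_m`. -/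
inductive FaceRel : PreRealization F X → PreRealization F X → Prop where
  | glue (m n : ℕ) (s : ⦋m⦌ₛ ⟶ ⦋n⦌ₛ) (α : F.simplices n) (a : X m) :
      FaceRel ⟨⟨m, F.map s.op α⟩, a⟩ ⟨⟨n, α⟩, dX m n (SemiSimplexCategory.homEquiv s) a⟩

/-- The quotient of `∐_n F_n × X_n` by the equivalence relation generated by
`(α s, a) ∼ (α, s_* a)`. -/
def Realization : Type (max u v) :=
  Quot (FaceRel F X dX)

variable {X} in
/-- The class of `(α, a)`. -/
def Realization.mk {n : ℕ} (α : F.simplices n) (a : X n) : Realization F X dX :=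
  Quot.mk _ ⟨⟨n, α⟩, a⟩

variable [∀ n, TopologicalSpace (X n)] [∀ n, TopologicalSpace (Y n)]

/-- The quotient topology. -/
instance : TopologicalSpace (Realization F X dX) :=
  inferInstanceAs (TopologicalSpace (Quot (FaceRel F X dX)))

variable {X Y} in
/-- The map `[α, a] ↦ [α, φ_n a]` induced on realizations by continuous maps `φ_n : X_n → Y_n` that
commute with the face maps. -/
def Realization.map (φ : ∀ n, C(X n, Y n))
    (hφ : ∀ (m n : ℕ) (s : Fin (m + 1) ↪o Fin (n + 1)) (a : X m),
      φ n (dX m n s a) = dY m n s (φ m a)) :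
    C(Realization F X dX, Realization F Y dY) where
  toFun := Quot.lift (fun x => Realization.mk F dY x.1.2 (φ x.1.1 x.2)) (by
    rintro _ _ ⟨m, n, s, α, a⟩
    dsimp only
    rw [hφ]
    exact Quot.sound (FaceRel.glue (dX := dY) _ _ s α (φ _ a)))
  continuous_toFun := by
    refine continuous_quot_lift _ (continuous_sigma fun α => ?_)
    exact continuous_quot_mk.comp
      ((continuous_sigmaMk (σ := fun β : (Σ n, F.simplices n) => Y β.1) (i := α)).comp
        (φ α.1).continuous)

end Realization

/-! ### The geometric realization -/

/-- The topological `n`-simplex `Δ_n`. -/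
abbrev Simplex (n : ℕ) : Type := stdSimplex ℝ (Fin (n + 1))

/-- The map `Δ(s) : Δ_m → Δ_n`, `(x_j)_j ↦ (∑_{s j = i} x_j)_i`. -/
abbrev Simplex.face (m n : ℕ) (s : Fin (m + 1) ↪o Fin (n + 1)) : Simplex m → Simplex n :=
  stdSimplex.map s

/-- The geometric realization `‖F‖`. -/
abbrev GeomReal (F : PreSimplicialSet.{u}) : Type u :=
  Realization F Simplex Simplex.face

/-! ### Spaces of random variables -/

/-- The measure has no atom: every measurable set of positive measure contains a measurable subset
of smaller positive measure. -/
def Atomless {Ω : Type v} [MeasurableSpace Ω] (μ : Measure Ω) : Prop :=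
  ∀ A : Set Ω, MeasurableSet A → 0 < μ A → ∃ B ⊆ A, MeasurableSet B ∧ 0 < μ B ∧ μ B < μ A

variable {Ω : Type v} [MeasurableSpace Ω]

/-- The space `▽_n = L¹(Ω, [n])` of random variables with values in `[n] = {0, …, n}`, up to almost
sure equality. -/
def RVSimplex (μ : Measure Ω) (n : ℕ) : Type v := Ω →ₘ[μ] Fin (n + 1)

namespace RVSimplex

variable {μ : Measure Ω} {m n : ℕ}

/-- A representative of a random variable. -/
instance : CoeFun (RVSimplex μ n) (fun _ => Ω → Fin (n + 1)) where
  coe f := AEEqFun.cast f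

lemma measurable (f : RVSimplex μ n) : Measurable (f : Ω → Fin (n + 1)) :=
  AEEqFun.measurable f

lemma ext {f g : RVSimplex μ n} (h : (f : Ω → Fin (n + 1)) =ᵐ[μ] g) : f = g :=
  AEEqFun.ext h

variable (m n) in
/-- The map `▽(s) : ▽_m → ▽_n`, `f ↦ s ∘ f`. -/
def face (s : Fin (m + 1) ↪o Fin (n + 1)) (f : RVSimplex μ m) : RVSimplex μ n :=
  AEEqFun.comp s continuous_of_discreteTopology f

lemma coe_face (s : Fin (m + 1) ↪o Fin (n + 1)) (f : RVSimplex μ m) :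
    (face m n s f : Ω → Fin (n + 1)) =ᵐ[μ] s ∘ f :=
  AEEqFun.coeFn_comp s continuous_of_discreteTopology f

variable [IsProbabilityMeasure μ]

/-- The `L¹` distance `d(f, g) = ∫ d(f(t), g(t)) dμ(t) = μ {t | f t ≠ g t}`, where `[n]` carries the
discrete distance (equal to `1` off the diagonal). -/
instance : MetricSpace (RVSimplex μ n) where
  dist f g := μ.real {t | f t ≠ g t}
  dist_self f := by simp
  dist_comm f g := by simp only [ne_comm]
  dist_triangle f g h := by
    refine (measureReal_mono ?_).trans
      (measureReal_union_le {t | f t ≠ g t} {t | g t ≠ h t})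
    intro t ht
    by_contra hc
    simp only [Set.mem_union, Set.mem_ofPred_eq, not_or, not_not] at hc
    exact ht (hc.1.trans hc.2)
  eq_of_dist_eq_zero {f g} h := by
    refine ext ?_
    have h' : μ {t | f t ≠ g t} = 0 := by
      simpa [measureReal_def, ENNReal.toReal_eq_zero_iff] using h
    exact h'

lemma dist_def (f g : RVSimplex μ n) : dist f g = μ.real {t | f t ≠ g t} := rfl

lemma sum_law (f : RVSimplex μ n) : ∑ i, μ.real (f ⁻¹' {i}) = 1 := by
  have h := measureReal_biUnion_finset (μ := μ) (s := Finset.univ)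
    (f := fun i : Fin (n + 1) => (f ⁻¹' {i} : Set Ω))
    (by
      intro i _ j _ hij
      exact Disjoint.preimage _ (by simpa using hij))
    (fun i _ => f.measurable (measurableSet_singleton i))
  rw [← h]
  have : (⋃ i ∈ (Finset.univ : Finset (Fin (n + 1))), (f ⁻¹' {i} : Set Ω)) = Set.univ := by
    ext t; simp
  rw [this]; simp

/-- The probability law `p_n(f) = (μ(f = i))_{i = 0, …, n} ∈ Δ_n` of a random variable. -/
def lawFun (f : RVSimplex μ n) : Simplex n :=
  ⟨fun i => μ.real (f ⁻¹' {i}), fun _ => measureReal_nonneg, sum_law f⟩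

lemma lawFun_apply (f : RVSimplex μ n) (i : Fin (n + 1)) : lawFun f i = μ.real (f ⁻¹' {i}) := rfl

lemma law_sub_le (f g : RVSimplex μ n) (i : Fin (n + 1)) :
    μ.real (f ⁻¹' {i}) - μ.real (g ⁻¹' {i}) ≤ dist f g := by
  rw [sub_le_iff_le_add', dist_def]
  refine (measureReal_mono ?_).trans (measureReal_union_le _ _)
  intro t ht
  by_cases h : g t = i
  · exact Or.inl h
  · refine Or.inr fun hc => h ?_
    rw [← hc]; exact ht

variable (μ n) in
/-- The probability-law map `p_n : ▽_n → Δ_n`. -/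
def law : C(RVSimplex μ n, Simplex n) where
  toFun := lawFun
  continuous_toFun := by
    refine Continuous.subtype_mk (continuous_pi fun i => ?_) _
    refine (LipschitzWith.of_dist_le_mul (K := 1) fun f g => ?_).continuous
    rw [NNReal.coe_one, one_mul, Real.dist_eq, abs_le]
    have h1 := law_sub_le f g i
    have h2 := law_sub_le g f i
    rw [dist_comm] at h2
    constructor <;> linarith

/-- The probability-law maps commute with the face maps. -/
lemma law_face (s : Fin (m + 1) ↪o Fin (n + 1)) (f : RVSimplex μ m) :
    law μ n (face m n s f) = Simplex.face m n s (law μ m f) := by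
  refine stdSimplex.ext (funext fun i => ?_)
  change μ.real (face m n s f ⁻¹' {i}) = FunOnFinite.linearMap ℝ ℝ s (lawFun f) i
  rw [FunOnFinite.linearMap_apply_apply]
  have h1 : μ.real (face m n s f ⁻¹' {i})
      = μ.real (⋃ j ∈ Finset.univ.filter (fun j => s j = i), (f ⁻¹' {j} : Set Ω)) := by
    refine measureReal_congr ?_
    filter_upwards [coe_face s f] with t ht
    refine propext ?_
    change face m n s f t = i ↔ t ∈ ⋃ j ∈ Finset.univ.filter (fun j => s j = i), (f ⁻¹' {j} : Set Ω)
    rw [show face m n s f t = s (f t) from ht]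
    simp
  rw [h1, measureReal_biUnion_finset]
  · rfl
  · intro a _ b _ hab
    exact Disjoint.preimage _ (by simpa using hab)
  · exact fun j _ => f.measurable (measurableSet_singleton j)

end RVSimplex

section RVRealization

variable (μ : Measure Ω) [IsProbabilityMeasure μ]

/-- The realization `𝕃(F)` of a pre-simplicial set by random variables. -/
abbrev RVReal (F : PreSimplicialSet.{u}) : Type (max u v) :=
  Realization F (RVSimplex μ) RVSimplex.face

/-- The probability-law map `p_F : 𝕃(F) → ‖F‖`, `[α, f] ↦ [α, p_n f]`. -/
def lawReal (F : PreSimplicialSet.{u}) : C(RVReal μ F, GeomReal F) :=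
  Realization.map F RVSimplex.face Simplex.face (fun n => RVSimplex.law μ n)
    (fun _ _ => RVSimplex.law_face)

end RVRealization

/-- An exhaustion map of a probability space: a path `t ↦ Ω_t` (`t ∈ [0,1]`) in its measure algebra
(measurable sets up to null sets), increasing and with `μ(Ω_t) = t`. It is given by representatives
`Ω_t`, whose values for `t ∉ [0,1]` are irrelevant. Continuity need not be required, since
`μ(Ω_s ∆ Ω_t) = |t - s|`. -/
structure Exhaustion (μ : Measure Ω) where
  /-- The set `Ω_t`. -/
  set : ℝ → Set Ω
  measurableSet : ∀ t ∈ Set.Icc (0 : ℝ) 1, MeasurableSet (set t)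
  mono : ∀ s ∈ Set.Icc (0 : ℝ) 1, ∀ t ∈ Set.Icc (0 : ℝ) 1, s ≤ t → set s ≤ᵐ[μ] set t
  measure : ∀ t ∈ Set.Icc (0 : ℝ) 1, μ (set t) = ENNReal.ofReal t

/-- A space has the homotopy type of a (Hausdorff) CW-complex. -/
def HasCWHomotopyType.{p, q} (Y : Type q) [TopologicalSpace Y] : Prop :=
  ∃ (X : Type p) (_ : TopologicalSpace X), T2Space X ∧
    Nonempty (Topology.CWComplex (Set.univ : Set X)) ∧ Nonempty (Y ≃ₕ X)

end RandomizedSimplicial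

end

/-!
The proof has three independent ingredients.

**The maps `σ_n` and `H_n`.** An exhaustion map is, up to null sets, the family of events `{U < t}`
of a random variable `U` uniformly distributed on `[0, 1]` (`Exhaustion.time`). A random variable
with values in `[n]` is determined by the events that it lies in a given lower set `J` of `[n]`, and
everything is defined and checked through these events. The section `σ_n(α)` is the quantile
function: it lies in `J` exactly when `U < ∑_{j ∈ J} α_j` (`Exhaustion.quantile_mem_iff`). The
homotopy rearranges `f` increasingly on `Ω_s = {U < s}` and keeps it elsewhere: the rearranged
variable lies in `J` exactly when `U < μ(f ∈ J, U < s)`, or `f ∈ J` and `s ≤ U`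
(`Exhaustion.rearrange_mem_iff`). With `s = 1 - r` this leads from `σ_n(p_n f)` to `f`. Both
characterizations hold for all lower sets, in particular for `{j | s j ≤ i}` where `s` is a face
map, which gives the compatibility with `s`; laws are preserved because the two events are
disjoint with total measure `μ(f ∈ J)`; and the distance between two random variables is at most
the sum of the measures of the symmetric differences of these events, which gives continuity.
The maps then descend to realizations, where `H_F` is continuous because a homotopy is a continuous
map to a space of paths.

**Existence of exhaustion maps.** In a maximal chain of measurable sets, ordered by inclusion up to
null sets, there is a greatest element of measure `≤ t` and a least one of measure `≥ t`. In an
atomless space both have measure `t`, since otherwise a further set would fit in between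
(`exists_measure_eq_of_isMaxChain`).

**`‖F‖` is a CW-complex.** To an `n`-simplex `x` and a continuous function `φ` that vanishes on
points having some coordinate `0` is attached the continuous function
`[z, c] ↦ ∑_{s : [n] → [m], z s = x} φ(c ∘ s)` on `‖F‖` (`cellFun`). It is given by `φ` on the open
cell of `x`, and vanishes on all other cells of dimension at most `n`. These functions separate
points, so `‖F‖` is Hausdorff and the open cells are disjoint; quotients of them are the barycentric
coordinates on the open cell of `x`, so that the characteristic map has a continuous inverse there.
-/

noncomputable section

namespace RandomizedSimplicial

universe u v w

/-! ### The geometric realization as a CW-complex -/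

lemma Simplex.face_apply {m n : ℕ} (s : Fin (m + 1) ↪o Fin (n + 1)) (a : Simplex m)
    (i : Fin (n + 1)) : Simplex.face m n s a i = ∑ j with s j = i, a j :=
  FunOnFinite.linearMap_apply_apply ℝ ℝ s a i

lemma Simplex.face_apply_self {m n : ℕ} (s : Fin (m + 1) ↪o Fin (n + 1)) (a : Simplex m)
    (j : Fin (m + 1)) : Simplex.face m n s a (s j) = a j := by
  rw [Simplex.face_apply, Finset.sum_eq_single_of_mem j (by simp)]
  intro k hk hkj
  exact absurd (s.injective (Finset.mem_filter.1 hk).2) hkj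

lemma Simplex.face_apply_of_notMem_range {m n : ℕ} (s : Fin (m + 1) ↪o Fin (n + 1))
    (a : Simplex m) {i : Fin (n + 1)} (hi : i ∉ Set.range s) : Simplex.face m n s a i = 0 := by
  rw [Simplex.face_apply]
  exact Finset.sum_eq_zero fun j hj => absurd ⟨j, (Finset.mem_filter.1 hj).2⟩ hi

/-- Every point of a simplex lies in the relative interior of a unique face, spanned by its
support. -/
lemma Simplex.exists_face_eq {n : ℕ} (a : Simplex n) :
    ∃ (m : ℕ) (s : Fin (m + 1) ↪o Fin (n + 1)) (b : Simplex m), (∀ j, 0 < b j) ∧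
      Simplex.face m n s b = a ∧ ((∃ i, a i = 0) → m < n) := by
  set S : Finset (Fin (n + 1)) := {i | a i ≠ 0} with hS
  have hsum : ∑ i ∈ S, a i = 1 := by
    rw [← stdSimplex.sum_eq_one a, hS, Finset.sum_filter_ne_zero]
  have hne : S.Nonempty := by
    by_contra h
    rw [Finset.not_nonempty_iff_eq_empty.1 h] at hsum
    simp at hsum
  obtain ⟨m, hm⟩ : ∃ m, S.card = m + 1 := Nat.exists_eq_add_one.2 hne.card_pos
  have hmem : ∀ j, a (S.orderEmbOfFin hm j) ≠ 0 := fun j =>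
    (Finset.mem_filter.1 (S.orderEmbOfFin_mem hm j)).2
  have hrange : Set.range (S.orderEmbOfFin hm) = S := S.range_orderEmbOfFin hm
  refine ⟨m, S.orderEmbOfFin hm, ⟨fun j => a (S.orderEmbOfFin hm j),
    fun j => stdSimplex.zero_le a _, ?_⟩, ?_, ?_, ?_⟩
  · rw [← hsum, ← Finset.sum_coe_sort S]
    exact (S.orderIsoOfFin hm).toEquiv.sum_comp fun i => a i
  · exact fun j => (stdSimplex.zero_le a _).lt_of_ne (hmem j).symm
  · refine stdSimplex.ext (funext fun i => ?_)
    by_cases hi : i ∈ Set.range (S.orderEmbOfFin hm)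
    · obtain ⟨j, rfl⟩ := hi
      exact Simplex.face_apply_self _ _ j
    · refine (Simplex.face_apply_of_notMem_range _ _ hi).trans ?_
      rw [hrange] at hi
      simpa [hS, eq_comm] using hi
  · rintro ⟨i, hi⟩
    have h := Finset.card_lt_univ_of_notMem (s := S) (x := i) (by simp [hS, hi])
    rw [hm, Fintype.card_fin] at h
    omega

lemma orderEmbedding_fin_eq_refl {k : ℕ} (s : Fin k ↪o Fin k) : s = RelEmbedding.refl _ := by
  refine DFunLike.coe_injective ((StrictMono.range_inj s.strictMono strictMono_id).1 ?_)
  rw [(Finite.injective_iff_surjective.1 s.injective).range_eq, Set.range_id]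

section CellFun

variable {F : PreSimplicialSet.{u}} {n : ℕ}

lemma simplices_map_id (z : F.simplices n) :
    F.map (SemiSimplexCategory.homEquiv.symm (RelEmbedding.refl _) : ⦋n⦌ₛ ⟶ ⦋n⦌ₛ).op z = z := by
  have : (SemiSimplexCategory.homEquiv.symm (RelEmbedding.refl _) : ⦋n⦌ₛ ⟶ ⦋n⦌ₛ) = 𝟙 _ := by
    ext1; simp
  rw [this]
  simp

lemma simplices_map_comp {k m : ℕ} (s : Fin (k + 1) ↪o Fin (m + 1)) (t : ⦋m⦌ₛ ⟶ ⦋n⦌ₛ)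
    (z : F.simplices n) :
    F.map (SemiSimplexCategory.homEquiv.symm
      (s.trans (SemiSimplexCategory.homEquiv t)) : ⦋k⦌ₛ ⟶ ⦋n⦌ₛ).op z =
    F.map (SemiSimplexCategory.homEquiv.symm s : ⦋k⦌ₛ ⟶ ⦋m⦌ₛ).op (F.map t.op z) := by
  have : (SemiSimplexCategory.homEquiv.symm
      (s.trans (SemiSimplexCategory.homEquiv t)) : ⦋k⦌ₛ ⟶ ⦋n⦌ₛ) =
      (SemiSimplexCategory.homEquiv.symm s : ⦋k⦌ₛ ⟶ ⦋m⦌ₛ) ≫ t := by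
    ext1; simp
  rw [this]
  simp

open Classical in
/-- The continuous function on `‖F‖` attached to an `n`-simplex `x` and to a continuous function `φ`
of `n + 1` real variables that vanishes as soon as one variable does: it maps `[z, c]`, for `z` of
dimension `m`, to `∑ φ(c ∘ s)`, the sum over the face maps `s : [n] → [m]` with `z s = x`. -/
def cellFun (x : F.simplices n) (φ : C(Fin (n + 1) → ℝ, ℝ))
    (hφ : ∀ c j, c j = 0 → φ c = 0) : C(GeomReal F, ℝ) where
  toFun := Quot.lift (fun z => ∑ s : Fin (n + 1) ↪o Fin (z.1.1 + 1),
      if F.map (SemiSimplexCategory.homEquiv.symm s : ⦋n⦌ₛ ⟶ ⦋z.1.1⦌ₛ).op z.1.2 = x then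
        φ (fun j => z.2 (s j)) else 0) (by
    rintro _ _ ⟨k, m, t, z, c⟩
    dsimp only
    refine Finset.sum_of_injOn (fun s => s.trans (SemiSimplexCategory.homEquiv t))
      (fun s _ s' _ h => ?_) (fun _ _ => Finset.mem_coe.2 (Finset.mem_univ _))
      (fun s _ hs => ?_) (fun s _ => ?_)
    · ext j : 1
      exact (SemiSimplexCategory.homEquiv t).injective (DFunLike.congr_fun h j)
    -- a face map that does not factor through `t` meets a coordinate where the point vanishes
    · by_cases h : ∀ j, s j ∈ Set.range (SemiSimplexCategory.homEquiv t)
      · choose g hg using h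
        refine absurd ⟨OrderEmbedding.ofMapLEIff g fun i j => ?_, by simp, ?_⟩ hs
        · rw [← (SemiSimplexCategory.homEquiv t).le_iff_le, hg, hg, s.le_iff_le]
        · ext j : 1
          exact hg j
      · push Not at h
        obtain ⟨j, hj⟩ := h
        rw [hφ (fun j => Simplex.face k m (SemiSimplexCategory.homEquiv t) c (s j)) j
          (Simplex.face_apply_of_notMem_range _ c hj), ite_self]
    · rw [simplices_map_comp]
      congr 2
      funext j
      exact (Simplex.face_apply_self _ _ _).symm)
  continuous_toFun := by
    refine continuous_quot_lift _ (continuous_sigma fun z => ?_)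
    change Continuous fun a : Simplex z.1 => ∑ s : Fin (n + 1) ↪o Fin (z.1 + 1),
      if F.map (SemiSimplexCategory.homEquiv.symm s : ⦋n⦌ₛ ⟶ ⦋z.1⦌ₛ).op z.2 = x then
        φ (fun j => a (s j)) else 0
    refine continuous_finsetSum _ fun s _ => ?_
    split_ifs
    · refine φ.continuous.comp (continuous_pi fun j => ?_)
      exact (continuous_apply (s j)).comp continuous_subtype_val
    · exact continuous_const

variable (x : F.simplices n) (φ : C(Fin (n + 1) → ℝ, ℝ)) (hφ : ∀ c j, c j = 0 → φ c = 0)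

lemma cellFun_mk_self (a : Simplex n) :
    cellFun x φ hφ (Realization.mk F Simplex.face x a) = φ a := by
  refine (Finset.sum_eq_single_of_mem (RelEmbedding.refl _) (Finset.mem_univ _)
    fun s _ hs => absurd (orderEmbedding_fin_eq_refl s) hs).trans ?_
  rw [if_pos (simplices_map_id x)]
  rfl

lemma cellFun_mk_of_ne {y : F.simplices n} (hy : y ≠ x) (a : Simplex n) :
    cellFun x φ hφ (Realization.mk F Simplex.face y a) = 0 := by
  refine Finset.sum_eq_zero fun s _ => if_neg ?_
  obtain rfl := orderEmbedding_fin_eq_refl s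
  rwa [simplices_map_id]

lemma cellFun_mk_of_lt {m : ℕ} (hm : m < n) (y : F.simplices m) (a : Simplex m) :
    cellFun x φ hφ (Realization.mk F Simplex.face y a) = 0 := by
  refine Finset.sum_eq_zero fun s _ => ?_
  have h := Fintype.card_le_of_injective s s.injective
  simp only [Fintype.card_fin] at h
  omega

/-- The product of the barycentric coordinates on the open cell of `x`, extended to `‖F‖`. -/
def cellBump : C(GeomReal F, ℝ) :=
  cellFun x ⟨fun c => ∏ j, c j, by fun_prop⟩ fun _ j h => Finset.prod_eq_zero (Finset.mem_univ j) h

/-- The barycentric coordinates of a point of the open cell of `x`. -/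
def cellCoord (p : GeomReal F) (i : Fin (n + 1)) : ℝ :=
  cellFun x ⟨fun c => c i * ∏ j, c j, by fun_prop⟩
    (fun _ j h => mul_eq_zero_of_right _ (Finset.prod_eq_zero (Finset.mem_univ j) h)) p /
      cellBump x p

variable {x}

lemma cellBump_mk_pos {a : Simplex n} (ha : ∀ j, 0 < a j) :
    0 < cellBump x (Realization.mk F Simplex.face x a) := by
  rw [cellBump, cellFun_mk_self]
  change 0 < ∏ j, a j
  exact Finset.prod_pos fun j _ => ha j

lemma cellCoord_mk {a : Simplex n} (ha : ∀ j, 0 < a j) :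
    cellCoord x (Realization.mk F Simplex.face x a) = a := by
  funext i
  rw [cellCoord, div_eq_iff (cellBump_mk_pos ha).ne', cellBump, cellFun_mk_self, cellFun_mk_self]
  rfl

lemma continuousOn_cellCoord : ContinuousOn (cellCoord x) {p | cellBump x p ≠ 0} :=
  continuousOn_pi.2 fun _ =>
    (ContinuousMap.continuous _).continuousOn.div (ContinuousMap.continuous _).continuousOn
      fun _ hp => hp

/-- The bump function of a cell vanishes on the other cells of the same or a smaller dimension, so
two distinct cells cannot both have a bump function that is nonzero somewhere on the other one. -/
lemma eq_of_cellBump_ne_zero {m : ℕ} {y : F.simplices m} {a : Simplex n} {b : Simplex m}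
    (hx : cellBump x (Realization.mk F Simplex.face y b) ≠ 0)
    (hy : cellBump y (Realization.mk F Simplex.face x a) ≠ 0) :
    (⟨n, x⟩ : Σ k, F.simplices k) = ⟨m, y⟩ := by
  rcases lt_trichotomy n m with h | rfl | h
  · exact absurd (cellFun_mk_of_lt _ _ _ h _ _) hy
  · by_contra hne
    exact hx (cellFun_mk_of_ne _ _ _ (fun h => hne (by rw [h])) _)
  · exact absurd (cellFun_mk_of_lt _ _ _ h _ _) hx

lemma Realization.exists_mk_pos (p : GeomReal F) :
    ∃ (n : ℕ) (x : F.simplices n) (a : Simplex n), (∀ j, 0 < a j) ∧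
      Realization.mk F Simplex.face x a = p := by
  obtain ⟨⟨⟨n, x⟩, a⟩, rfl⟩ := Quot.exists_rep p
  obtain ⟨m, s, b, hb, rfl, -⟩ := a.exists_face_eq
  refine ⟨m, F.map (SemiSimplexCategory.homEquiv.symm s : ⦋m⦌ₛ ⟶ ⦋n⦌ₛ).op x, b, hb, ?_⟩
  exact Quot.sound (FaceRel.glue (dX := Simplex.face) m n
    (SemiSimplexCategory.homEquiv.symm s) x b)

instance : T2Space (GeomReal F) := by
  refine ⟨fun p q hpq => ?_⟩
  obtain ⟨n, x, a, ha, rfl⟩ := Realization.exists_mk_pos p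
  obtain ⟨m, y, b, hb, rfl⟩ := Realization.exists_mk_pos q
  by_cases hx : cellBump x (Realization.mk F Simplex.face y b) = 0
  · exact separated_by_continuous (cellBump x).continuous
      (by rw [hx]; exact (cellBump_mk_pos ha).ne')
  by_cases hy : cellBump y (Realization.mk F Simplex.face x a) = 0
  · exact separated_by_continuous (cellBump y).continuous
      (by rw [hy]; exact (cellBump_mk_pos hb).ne)
  obtain ⟨rfl, h⟩ := Sigma.mk.inj_iff.1 (eq_of_cellBump_ne_zero hx hy)
  obtain rfl := eq_of_heq h
  obtain ⟨i, hi⟩ : ∃ i, a i ≠ b i := by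
    by_contra! h
    exact hpq (by rw [stdSimplex.ext (funext h)])
  by_cases hbump : cellBump x (Realization.mk F Simplex.face x a) =
      cellBump x (Realization.mk F Simplex.face x b)
  · refine separated_by_continuous (cellFun x ⟨fun c => c i * ∏ j, c j, by fun_prop⟩
      (fun _ j h => mul_eq_zero_of_right _
        (Finset.prod_eq_zero (Finset.mem_univ j) h))).continuous ?_
    have hpos := cellBump_mk_pos (x := x) hb
    simp only [cellBump, cellFun_mk_self, ContinuousMap.coe_mk] at hbump hpos ⊢
    rw [hbump]
    exact fun h => hi (mul_right_cancel₀ hpos.ne' h)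
  · exact separated_by_continuous (cellBump x).continuous hbump

end CellFun

section CWStructure

open Metric

/-- The simplex `{y | 0 ≤ y, ∑ y ≤ 1}` with nonempty interior: the simplex `Δ_n` without its
`0`-th coordinate. -/
def cornerSimplex (n : ℕ) : Set (Fin n → ℝ) := {y | (∀ i, 0 ≤ y i) ∧ ∑ i, y i ≤ 1}

lemma convex_cornerSimplex (n : ℕ) : Convex ℝ (cornerSimplex n) := by
  rintro x ⟨hx, hx'⟩ y ⟨hy, hy'⟩ a b ha hb hab
  refine ⟨fun i => ?_, ?_⟩
  · have := mul_nonneg ha (hx i)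
    have := mul_nonneg hb (hy i)
    simpa using by linarith
  · simp only [Pi.add_apply, Pi.smul_apply, smul_eq_mul, Finset.sum_add_distrib, ← Finset.mul_sum]
    nlinarith

lemma isClosed_cornerSimplex (n : ℕ) : IsClosed (cornerSimplex n) := by
  have hsum : Continuous fun y : Fin n → ℝ => ∑ i, y i := by fun_prop
  exact (isClosed_Ici (a := (0 : Fin n → ℝ))).inter (isClosed_le hsum continuous_const)

lemma interior_cornerSimplex (n : ℕ) :
    interior (cornerSimplex n) = {y | (∀ i, 0 < y i) ∧ ∑ i, y i < 1} := by
  refine subset_antisymm (fun y hy => ?_) (interior_maximal ?_ ?_)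
  · obtain ⟨ε, hε, hball⟩ := Metric.mem_nhds_iff.1 (mem_interior_iff_mem_nhds.1 hy)
    have hshift : ∀ (i : Fin n) (δ : ℝ), ‖δ‖ < ε → y + Pi.single i δ ∈ cornerSimplex n :=
      fun i δ hδ => hball (by simpa [dist_eq_norm, Pi.norm_single] using hδ)
    have hε2 : ‖ε / 2‖ < ε := by rw [Real.norm_of_nonneg (half_pos hε).le]; linarith
    refine ⟨fun i => ?_, ?_⟩
    · have h := (hshift i (-(ε / 2)) (by rwa [norm_neg])).1 i
      simp only [Pi.add_apply, Pi.single_eq_same] at h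
      linarith
    · rcases isEmpty_or_nonempty (Fin n) with _ | ⟨⟨i⟩⟩
      · simp
      · have h := (hshift i (ε / 2) hε2).2
        simp only [Pi.add_apply, Finset.sum_add_distrib, Finset.sum_pi_single',
          Finset.mem_univ, if_true] at h
        linarith
  · exact fun y hy => ⟨fun i => (hy.1 i).le, hy.2.le⟩
  · have hsum : Continuous fun y : Fin n → ℝ => ∑ i, y i := by fun_prop
    have hpos : IsOpen (⋂ i, (fun y : Fin n → ℝ => y i) ⁻¹' Set.Ioi 0) :=
      isOpen_iInter_of_finite fun i => isOpen_Ioi.preimage (continuous_apply i)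
    convert hpos.inter (isOpen_lt hsum (continuous_const (y := (1 : ℝ)))) using 1
    ext y
    simp

lemma isBounded_cornerSimplex (n : ℕ) : Bornology.IsBounded (cornerSimplex n) := by
  refine (isBounded_closedBall (x := (0 : Fin n → ℝ)) (r := 1)).subset fun y hy => ?_
  rw [mem_closedBall_zero_iff, pi_norm_le_iff_of_nonneg zero_le_one]
  intro i
  rw [Real.norm_of_nonneg (hy.1 i)]
  exact (Finset.single_le_sum (fun j _ => hy.1 j) (Finset.mem_univ i)).trans hy.2

lemma interior_cornerSimplex_nonempty (n : ℕ) : (interior (cornerSimplex n)).Nonempty := by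
  rw [interior_cornerSimplex]
  refine ⟨fun _ => 1 / (n + 1), fun _ => by positivity, ?_⟩
  rw [Finset.sum_const, Finset.card_univ, Fintype.card_fin, nsmul_eq_mul, mul_one_div,
    div_lt_one (by positivity)]
  linarith

/-- The closed ball is homeomorphic to `Δ_n`, the open ball corresponding to the points with
positive coordinates. The map `ζ` to the ball is given as the restriction of a map defined on the
whole vector space. -/
lemma exists_ball_parametrization (n : ℕ) :
    ∃ (θ : (Fin n → ℝ) → Simplex n) (ζ : (Fin (n + 1) → ℝ) → (Fin n → ℝ)),
      ContinuousOn θ (closedBall 0 1) ∧ Continuous ζ ∧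
      (∀ a : Simplex n, ζ a ∈ closedBall 0 1 ∧ θ (ζ a) = a) ∧
      (∀ y ∈ closedBall (0 : Fin n → ℝ) 1, ζ (θ y) = y) ∧
      (∀ a : Simplex n, ζ a ∈ ball 0 1 ↔ ∀ i, 0 < a i) := by
  obtain ⟨h, hint, hcl, -⟩ := exists_homeomorph_image_interior_closure_frontier_eq_unitBall
    (convex_cornerSimplex n) (interior_cornerSimplex_nonempty n) (isBounded_cornerSimplex n)
  rw [(isClosed_cornerSimplex n).closure_eq] at hcl
  have hmem : ∀ y, h.symm y ∈ cornerSimplex n ↔ y ∈ closedBall 0 1 := fun y => by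
    rw [← hcl, h.image_eq_preimage_symm]; rfl
  have htail : ∀ a : Simplex n, (fun i : Fin n => a i.succ) ∈ cornerSimplex n := fun a => by
    refine ⟨fun i => stdSimplex.zero_le a _, ?_⟩
    have := stdSimplex.sum_eq_one a
    rw [Fin.sum_univ_succ] at this
    have := stdSimplex.zero_le a 0
    linarith
  let cons : (Fin n → ℝ) → Fin (n + 1) → ℝ := fun y => Fin.cons (1 - ∑ i, y i) y
  have hcons : ∀ y ∈ cornerSimplex n, cons y ∈ stdSimplex ℝ (Fin (n + 1)) := fun y hy => by
    refine ⟨?_, ?_⟩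
    · intro i
      refine Fin.cases ?_ (fun j => ?_) i
      · simpa [cons] using hy.2
      · simpa [cons] using hy.1 j
    · simp [cons, Fin.sum_univ_succ]
  have hcons' : Continuous cons := by
    refine continuous_pi (Fin.cases ?_ fun i => ?_)
    · simp only [cons, Fin.cons_zero]; fun_prop
    · simp only [cons, Fin.cons_succ]; fun_prop
  classical
  let θ : (Fin n → ℝ) → Simplex n := fun y =>
    if hy : h.symm y ∈ cornerSimplex n then ⟨cons (h.symm y), hcons _ hy⟩ else Classical.arbitrary _
  have hθ : ∀ y ∈ closedBall (0 : Fin n → ℝ) 1, (θ y : Fin (n + 1) → ℝ) = cons (h.symm y) :=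
    fun y hy => by
      simp only [θ, dif_pos ((hmem y).2 hy)]; rfl
  refine ⟨θ, fun a => h fun i => a i.succ, ?_, by fun_prop, fun a => ?_, fun y hy => ?_,
    fun a => ?_⟩
  · exact Topology.IsInducing.subtypeVal.continuousOn_iff.2
      ((hcons'.comp h.symm.continuous).continuousOn.congr hθ)
  · have hb : h (fun i => a i.succ) ∈ closedBall 0 1 := by
      rw [← hmem, h.symm_apply_apply]; exact htail a
    refine ⟨hb, stdSimplex.ext ?_⟩
    rw [hθ _ hb, h.symm_apply_apply]
    funext i
    refine Fin.cases ?_ (fun i => ?_) i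
    · have := stdSimplex.sum_eq_one a
      rw [Fin.sum_univ_succ] at this
      simp only [cons, Fin.cons_zero]
      linarith
    · simp [cons]
  · rw [hθ y hy]
    simp [cons]
  · rw [← hint, h.injective.mem_set_image, interior_cornerSimplex]
    have := stdSimplex.sum_eq_one a
    rw [Fin.sum_univ_succ] at this
    rw [Fin.forall_fin_succ]
    constructor
    · rintro ⟨h1, h2⟩
      exact ⟨by linarith, h1⟩
    · rintro ⟨h1, h2⟩
      refine ⟨h2, ?_⟩
      linarith

/-- A parametrization of `Δ_n` by the closed unit ball for the sup norm. -/
def ballToSimplex (n : ℕ) : (Fin n → ℝ) → Simplex n := (exists_ball_parametrization n).choose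

/-- The inverse of `ballToSimplex`, extended to all vectors. -/
def simplexToBall (n : ℕ) : (Fin (n + 1) → ℝ) → (Fin n → ℝ) :=
  (exists_ball_parametrization n).choose_spec.choose

section

variable {n : ℕ}

lemma continuousOn_ballToSimplex : ContinuousOn (ballToSimplex n) (closedBall 0 1) :=
  (exists_ball_parametrization n).choose_spec.choose_spec.1

lemma continuous_simplexToBall : Continuous (simplexToBall n) :=
  (exists_ball_parametrization n).choose_spec.choose_spec.2.1

lemma simplexToBall_mem_closedBall (a : Simplex n) : simplexToBall n a ∈ closedBall 0 1 :=
  ((exists_ball_parametrization n).choose_spec.choose_spec.2.2.1 a).1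

lemma ballToSimplex_simplexToBall (a : Simplex n) : ballToSimplex n (simplexToBall n a) = a :=
  ((exists_ball_parametrization n).choose_spec.choose_spec.2.2.1 a).2

lemma simplexToBall_ballToSimplex {y : Fin n → ℝ} (hy : y ∈ closedBall 0 1) :
    simplexToBall n (ballToSimplex n y) = y :=
  (exists_ball_parametrization n).choose_spec.choose_spec.2.2.2.1 y hy

lemma simplexToBall_mem_ball {a : Simplex n} : simplexToBall n a ∈ ball 0 1 ↔ ∀ i, 0 < a i :=
  (exists_ball_parametrization n).choose_spec.choose_spec.2.2.2.2 a

lemma ballToSimplex_pos {y : Fin n → ℝ} (hy : y ∈ ball 0 1) (i : Fin (n + 1)) :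
    0 < ballToSimplex n y i := by
  refine simplexToBall_mem_ball.1 ?_ i
  rwa [simplexToBall_ballToSimplex (ball_subset_closedBall hy)]

lemma exists_ballToSimplex_eq_zero {y : Fin n → ℝ} (hy : y ∈ sphere 0 1) :
    ∃ i, ballToSimplex n y i = 0 := by
  by_contra! h
  have := simplexToBall_mem_ball.2 fun i => (stdSimplex.zero_le (ballToSimplex n y) i).lt_of_ne'
    (h i)
  rw [simplexToBall_ballToSimplex (sphere_subset_closedBall hy)] at this
  exact (mem_ball.1 this).ne (mem_sphere.1 hy)

end

variable {F : PreSimplicialSet.{u}}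

lemma continuous_mk {n : ℕ} (x : F.simplices n) :
    Continuous (Realization.mk F Simplex.face x) :=
  continuous_quot_mk.comp
    (continuous_sigmaMk (σ := fun β : (Σ n, F.simplices n) => Simplex β.1) (i := ⟨n, x⟩))

/-- The characteristic map of the cell of `x`. -/
def cellMap {n : ℕ} (x : F.simplices n) : PartialEquiv (Fin n → ℝ) (GeomReal F) where
  toFun y := Realization.mk F Simplex.face x (ballToSimplex n y)
  invFun p := simplexToBall n (cellCoord x p)
  source := ball 0 1
  target := (fun y => Realization.mk F Simplex.face x (ballToSimplex n y)) '' ball 0 1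
  map_source' _ hy := Set.mem_image_of_mem _ hy
  map_target' := by
    rintro _ ⟨y, hy, rfl⟩
    rwa [cellCoord_mk (ballToSimplex_pos hy),
      simplexToBall_ballToSimplex (ball_subset_closedBall hy)]
  left_inv' y hy := by
    rw [cellCoord_mk (ballToSimplex_pos hy),
      simplexToBall_ballToSimplex (ball_subset_closedBall hy)]
  right_inv' := by
    rintro _ ⟨y, hy, rfl⟩
    dsimp only
    rw [cellCoord_mk (ballToSimplex_pos hy),
      simplexToBall_ballToSimplex (ball_subset_closedBall hy)]

lemma cellMap_apply {n : ℕ} (x : F.simplices n) (y : Fin n → ℝ) :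
    cellMap x y = Realization.mk F Simplex.face x (ballToSimplex n y) := rfl

lemma image_cellMap_closedBall {n : ℕ} (x : F.simplices n) :
    cellMap x '' closedBall 0 1 = Set.range (Realization.mk F Simplex.face x) := by
  refine subset_antisymm ?_ ?_
  · rintro _ ⟨y, -, rfl⟩
    exact ⟨_, rfl⟩
  · rintro _ ⟨a, rfl⟩
    refine ⟨_, simplexToBall_mem_closedBall a, ?_⟩
    rw [cellMap_apply, ballToSimplex_simplexToBall]

variable (F)

/-- The CW-structure of `‖F‖`, with one `n`-cell for each `n`-simplex of `F`. -/
@[reducible]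
def geomRealCWComplex : Topology.CWComplex (Set.univ : Set (GeomReal F)) where
  cell n := F.simplices n
  map _ x := cellMap x
  source_eq _ _ := rfl
  continuousOn _ x := (continuous_mk x).comp_continuousOn continuousOn_ballToSimplex
  continuousOn_symm n x := by
    refine continuous_simplexToBall.comp_continuousOn (continuousOn_cellCoord.mono ?_)
    rintro _ ⟨y, hy, rfl⟩
    exact (cellBump_mk_pos (ballToSimplex_pos hy)).ne'
  pairwiseDisjoint' := by
    rintro ⟨n, x⟩ - ⟨m, y⟩ - hne
    refine Set.disjoint_left.2 ?_
    rintro _ ⟨a, ha, rfl⟩ ⟨b, hb, hab⟩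
    simp only [cellMap_apply] at hab
    refine hne (eq_of_cellBump_ne_zero (a := ballToSimplex n a) (b := ballToSimplex m b) ?_ ?_)
    · rw [hab]
      exact (cellBump_mk_pos (ballToSimplex_pos ha)).ne'
    · rw [← hab]
      exact (cellBump_mk_pos (ballToSimplex_pos hb)).ne'
  mapsTo' n x := by
    classical
    refine ⟨fun m => Finset.univ.image fun s : Fin (m + 1) ↪o Fin (n + 1) =>
      F.map (SemiSimplexCategory.homEquiv.symm s : ⦋m⦌ₛ ⟶ ⦋n⦌ₛ).op x, fun y hy => ?_⟩
    obtain ⟨m, s, b, -, hb, hm⟩ := (ballToSimplex n y).exists_face_eq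
    simp only [Set.mem_iUnion]
    refine ⟨m, hm (exists_ballToSimplex_eq_zero hy), _,
      Finset.mem_image_of_mem _ (Finset.mem_univ s), ?_⟩
    rw [image_cellMap_closedBall]
    refine ⟨b, ?_⟩
    rw [cellMap_apply, ← hb]
    exact Quot.sound (FaceRel.glue (dX := Simplex.face) m n
      (SemiSimplexCategory.homEquiv.symm s) x b)
  closed' A _ hA := by
    refine isClosed_coinduced.2 (isClosed_sigma_iff.2 fun ⟨n, x⟩ => ?_)
    have h := (hA n x).preimage (continuous_mk x)
    rwa [image_cellMap_closedBall, Set.preimage_inter_range] at h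
  union' := by
    refine Set.eq_univ_of_forall fun p => ?_
    obtain ⟨n, x, a, -, rfl⟩ := Realization.exists_mk_pos p
    simp only [Set.mem_iUnion, image_cellMap_closedBall]
    exact ⟨n, x, a, rfl⟩

end CWStructure

/-! ### Exhaustion maps and uniform random variables -/

section Exhaustion

variable {Ω : Type v} [MeasurableSpace Ω]

/-- Inclusion up to null sets, as a relation between measurable sets. -/
def AELE (μ : Measure Ω) (A B : {A : Set Ω // MeasurableSet A}) : Prop := A.1 ≤ᵐ[μ] B.1

variable {μ : Measure Ω} {c : Set {A : Set Ω // MeasurableSet A}}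

instance : Std.Refl (AELE μ) := ⟨fun _ => Filter.EventuallyLE.refl _ _⟩

lemma mem_of_isMaxChain_of_comparable (hc : IsMaxChain (AELE μ) c)
    {A : {A : Set Ω // MeasurableSet A}}
    (hA : ∀ B ∈ c, AELE μ A B ∨ AELE μ B A) : A ∈ c := by
  rw [hc.2 (hc.1.insert fun B hB _ => hA B hB) (Set.subset_insert A c)]
  exact Set.mem_insert A c

/-- A maximal chain has a greatest element among those of measure at most `t`. -/
lemma exists_greatest_of_isMaxChain [IsFiniteMeasure μ] (hc : IsMaxChain (AELE μ) c) (t : ENNReal) :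
    ∃ A ∈ c, μ A.1 ≤ t ∧ ∀ B ∈ c, μ B.1 ≤ t → AELE μ B A := by
  set S : Set ENNReal := (fun A => μ A.1) '' {A | A ∈ c ∧ μ A.1 ≤ t} with hS
  have hSne : S.Nonempty := by
    refine ⟨_, ⟨∅, .empty⟩, ⟨mem_of_isMaxChain_of_comparable hc fun B _ => Or.inl ?_, by simp⟩, rfl⟩
    exact Filter.Eventually.of_forall fun ω hω => absurd hω (Set.notMem_empty ω)
  obtain ⟨u, -, hu, huS⟩ := exists_seq_tendsto_sSup hSne (OrderTop.bddAbove S)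
  choose A hA hAu using huS
  -- finite unions of elements of a chain are, up to null sets, elements of the chain
  have hacc : ∀ n, ∃ k, Set.accumulate (fun k => (A k).1) n =ᵐ[μ] (A k).1 := by
    intro n
    induction n with
    | zero => exact ⟨0, .of_eq (Set.accumulate_zero_nat _)⟩
    | succ n ih =>
      obtain ⟨k, hk⟩ := ih
      rw [Set.accumulate_succ]
      rcases hc.1.total (hA k).1 (hA (n + 1)).1 with h | h
      · refine ⟨n + 1, (hk.union Filter.EventuallyEq.rfl).trans ?_⟩
        filter_upwards [h] with ω hω
        exact propext ⟨fun h => h.elim (fun h => hω h) id, Or.inr⟩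
      · refine ⟨k, (hk.union Filter.EventuallyEq.rfl).trans ?_⟩
        filter_upwards [h] with ω hω
        exact propext ⟨fun h => h.elim id fun h => hω h, Or.inl⟩
  let M : {A : Set Ω // MeasurableSet A} :=
    ⟨⋃ k, (A k).1, MeasurableSet.iUnion fun k => (A k).2⟩
  have hle : ∀ k, AELE μ (A k) M := fun k =>
    (Set.subset_iUnion (fun k => (A k).1) k).eventuallyLE
  have hM : ∀ B, (∀ k, AELE μ (A k) B) → AELE μ M B := fun B h => by
    filter_upwards [ae_all_iff.2 h] with ω hω hωM
    obtain ⟨k, hk⟩ := Set.mem_iUnion.1 hωM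
    exact hω k hk
  have hmem : M ∈ c := mem_of_isMaxChain_of_comparable hc fun B hB => by
    by_cases h : ∀ k, AELE μ (A k) B
    · exact Or.inl (hM B h)
    · push Not at h
      obtain ⟨k, hk⟩ := h
      exact Or.inr (((hc.1.total (hA k).1 hB).resolve_left hk).trans (hle k))
  have hMt : μ M.1 ≤ t := by
    change μ (⋃ k, (A k).1) ≤ t
    rw [measure_iUnion_eq_iSup_accumulate]
    refine iSup_le fun n => ?_
    obtain ⟨k, hk⟩ := hacc n
    rw [measure_congr hk]
    exact (hA k).2
  refine ⟨M, hmem, hMt, fun B hB hBt => ?_⟩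
  rcases hc.1.total hB hmem with h | h
  · exact h
  -- an element above `M` has measure at most `sup S ≤ μ M`
  · refine (ae_eq_of_ae_subset_of_measure_ge h ?_ M.2.nullMeasurableSet
      (measure_ne_top _ _)).symm.le
    refine (le_sSup (s := S) (a := μ B.1) ⟨B, ⟨hB, hBt⟩, rfl⟩).trans
      (le_of_tendsto' hu fun k => ?_)
    rw [← hAu]
    exact measure_mono_ae (hle k)

lemma isMaxChain_image_compl (hc : IsMaxChain (AELE μ) c) :
    IsMaxChain (AELE μ) ((fun A => (⟨A.1ᶜ, A.2.compl⟩ : {A : Set Ω // MeasurableSet A})) '' c) := by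
  let e : AELE μ ≃r flip (AELE μ) :=
    { toFun := fun A => ⟨A.1ᶜ, A.2.compl⟩
      invFun := fun A => ⟨A.1ᶜ, A.2.compl⟩
      left_inv := fun A => Subtype.ext (compl_compl _)
      right_inv := fun A => Subtype.ext (compl_compl _)
      map_rel_iff' := fun {A B} => Filter.eventually_congr
        (Filter.Eventually.of_forall fun ω => not_imp_not) }
  exact (hc.image e).symm

/-- In an atomless probability space, a maximal chain takes all possible measures: a gap could be
filled by a subset of it of intermediate measure. -/
lemma exists_measure_eq_of_isMaxChain [IsProbabilityMeasure μ]
    (hc : IsMaxChain (AELE μ) c) (hμ : Atomless μ) {t : ENNReal} (ht : t ≤ 1) :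
    ∃ A ∈ c, μ A.1 = t := by
  obtain ⟨A, hA, hAt, hAmax⟩ := exists_greatest_of_isMaxChain hc t
  obtain ⟨_, ⟨B, hB, rfl⟩, hBt, hBmax⟩ :=
    exists_greatest_of_isMaxChain (isMaxChain_image_compl hc) (1 - t)
  have hcompl : ∀ X : {A : Set Ω // MeasurableSet A}, t ≤ μ X.1 ↔ μ X.1ᶜ ≤ 1 - t := fun X => by
    rw [prob_compl_eq_one_sub X.2]
    refine ⟨fun h => tsub_le_tsub_left h 1, fun h => ?_⟩
    rwa [ENNReal.sub_le_sub_iff_left ht ENNReal.one_ne_top] at h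
  have hBmin : ∀ X ∈ c, t ≤ μ X.1 → AELE μ B X := fun X hX hXt => by
    filter_upwards [hBmax _ ⟨X, hX, rfl⟩ ((hcompl X).1 hXt)] with ω hω
    exact not_imp_not.1 hω
  replace hBt : t ≤ μ B.1 := (hcompl B).2 hBt
  refine ⟨A, hA, hAt.antisymm (le_of_not_gt fun hlt => ?_)⟩
  have hAB : AELE μ A B := (hc.1.total hA hB).resolve_right fun h =>
    (hlt.trans_le hBt).not_ge (measure_mono_ae h)
  have hpos : 0 < μ (B.1 \ A.1) := by
    refine pos_iff_ne_zero.2 fun h => (hlt.trans_le hBt).not_ge (measure_mono_ae ?_)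
    exact ae_le_set.2 h
  obtain ⟨D, hDsub, hD, hD0, hDlt⟩ := hμ _ (B.2.diff A.2) hpos
  let X : {A : Set Ω // MeasurableSet A} := ⟨A.1 ∪ D, A.2.union hD⟩
  have hXB : AELE μ X B := by
    filter_upwards [hAB] with ω hω h
    exact h.elim (fun h => hω h) fun h => (hDsub h).1
  have hX : X ∈ c := mem_of_isMaxChain_of_comparable hc fun Y hY => by
    rcases le_total (μ Y.1) t with h | h
    · exact Or.inr ((hAmax Y hY h).trans Set.subset_union_left.eventuallyLE)
    · exact Or.inl (hXB.trans (hBmin Y hY h))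
  rcases le_total (μ X.1) t with h | h
  · refine hD0.ne' (measure_mono_null (fun ω hω => ?_) (ae_le_set.1 (hAmax X hX h)))
    exact ⟨Or.inr hω, (hDsub hω).2⟩
  · refine hDlt.not_ge (measure_mono_ae ?_)
    filter_upwards [hBmin X hX h] with ω hω hωB
    exact (hω hωB.1).resolve_left hωB.2

lemma nonempty_exhaustion [IsProbabilityMeasure μ] (hμ : Atomless μ) :
    Nonempty (Exhaustion μ) := by
  have hc : IsMaxChain (AELE μ) (maxChain (AELE μ)) := maxChain_spec
  have h : ∀ t : ℝ, ∃ A ∈ maxChain (AELE μ), t ∈ Set.Icc (0 : ℝ) 1 → μ A.1 = ENNReal.ofReal t := by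
    intro t
    by_cases ht : t ∈ Set.Icc (0 : ℝ) 1
    · obtain ⟨A, hA, h⟩ := exists_measure_eq_of_isMaxChain hc hμ (ENNReal.ofReal_le_one.2 ht.2)
      exact ⟨A, hA, fun _ => h⟩
    · obtain ⟨A, hA, -⟩ := exists_greatest_of_isMaxChain hc 0
      exact ⟨A, hA, fun h => absurd h ht⟩
  choose A hA hAt using h
  refine ⟨⟨fun t => (A t).1, fun t _ => (A t).2, fun s hs t ht hst => ?_, hAt⟩⟩
  rcases hc.1.total (hA s) (hA t) with h | h
  · exact h
  · refine (ae_eq_of_ae_subset_of_measure_ge h ?_ (A t).2.nullMeasurableSet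
      (measure_ne_top _ _)).symm.le
    rw [hAt s hs, hAt t ht]
    exact ENNReal.ofReal_le_ofReal hst

namespace Exhaustion

variable (E : Exhaustion μ)

open Classical in
/-- The time at which a point enters the sets of an exhaustion, a random variable uniformly
distributed on `[0, 1]`. Only rational times are considered, to ensure measurability. -/
def time (ω : Ω) : ℝ :=
  ⨅ q : {q : ℚ // (q : ℝ) ∈ Set.Icc (0 : ℝ) 1}, if ω ∈ E.set q then (q : ℝ) else 1

lemma time_nonneg (ω : Ω) : 0 ≤ E.time ω := by
  refine Real.iInf_nonneg fun q => ?_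
  split_ifs
  exacts [q.2.1, zero_le_one]

lemma measurable_time : Measurable E.time := by
  refine Measurable.iInf fun q => ?_
  exact Measurable.ite (E.measurableSet _ q.2) measurable_const measurable_const

lemma time_lt_iff {t : ℝ} (ht : t ≤ 1) (ω : Ω) :
    E.time ω < t ↔ ∃ q : {q : ℚ // (q : ℝ) ∈ Set.Icc (0 : ℝ) 1}, (q : ℝ) < t ∧ ω ∈ E.set q := by
  have : Nonempty {q : ℚ // (q : ℝ) ∈ Set.Icc (0 : ℝ) 1} := ⟨⟨0, by simp⟩⟩
  rw [time, ciInf_lt_iff]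
  · refine exists_congr fun q => ?_
    split_ifs with h
    · simp [h]
    · simpa [h] using ht
  · refine ⟨0, ?_⟩
    rintro _ ⟨q, rfl⟩
    dsimp only
    split_ifs
    exacts [q.2.1, zero_le_one]

variable [IsProbabilityMeasure μ]

lemma setOf_time_lt_ae_eq {t : ℝ} (ht : t ∈ Set.Icc (0 : ℝ) 1) :
    {ω | E.time ω < t} =ᵐ[μ] E.set t := by
  refine ae_eq_of_ae_subset_of_measure_ge ?_ ?_
    (measurableSet_lt E.measurable_time measurable_const).nullMeasurableSet (measure_ne_top _ _)
  · have h : ∀ q : {q : ℚ // (q : ℝ) ∈ Set.Icc (0 : ℝ) 1}, (q : ℝ) < t →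
        E.set q ≤ᵐ[μ] E.set t := fun q hq => E.mono q q.2 t ht hq.le
    filter_upwards [ae_all_iff.2 fun q => ae_all_iff.2 (h q)] with ω hω hωt
    obtain ⟨q, hq, hωq⟩ := (E.time_lt_iff ht.2 ω).1 hωt
    exact hω q hq hωq
  · rw [E.measure t ht]
    rw [ENNReal.ofReal_le_iff_le_toReal (measure_ne_top _ _)]
    refine le_of_forall_rat_lt_imp_le fun q hq => ?_
    rcases le_total (q : ℝ) 0 with h0 | h0
    · exact h0.trans ENNReal.toReal_nonneg
    · have hq1 : (q : ℝ) ∈ Set.Icc (0 : ℝ) 1 := ⟨h0, hq.le.trans ht.2⟩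
      rw [← ENNReal.toReal_ofReal h0, ← E.measure q hq1]
      refine ENNReal.toReal_mono (measure_ne_top _ _) (measure_mono fun ω hω => ?_)
      exact (E.time_lt_iff ht.2 ω).2 ⟨⟨q, hq1⟩, hq, hω⟩

lemma measureReal_time_lt {t : ℝ} (ht : t ∈ Set.Icc (0 : ℝ) 1) :
    μ.real {ω | E.time ω < t} = t := by
  rw [measureReal_congr (E.setOf_time_lt_ae_eq ht), measureReal_def, E.measure t ht,
    ENNReal.toReal_ofReal ht.1]

lemma ae_time_lt_one : ∀ᵐ ω ∂μ, E.time ω < 1 := by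
  have h := E.measureReal_time_lt (t := 1) (by simp)
  rw [measureReal_def, ENNReal.toReal_eq_one_iff] at h
  exact (prob_compl_eq_zero_iff (measurableSet_lt E.measurable_time measurable_const)).2 h

end Exhaustion
end Exhaustion

/-! ### Random variables and laws through their lower sets -/

section LowerSets

variable {n : ℕ}

lemma eq_empty_or_eq_filter_le {J : Finset (Fin (n + 1))}
    (hJ : IsLowerSet (J : Set (Fin (n + 1)))) :
    J = ∅ ∨ ∃ k, J = ({j | j ≤ k} : Finset (Fin (n + 1))) := by
  rcases J.eq_empty_or_nonempty with h | h
  · exact Or.inl h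
  · refine Or.inr ⟨J.max' h, ?_⟩
    ext j
    simp only [Finset.mem_filter, Finset.mem_univ, true_and]
    exact ⟨J.le_max' j, fun hj => hJ hj (J.max'_mem h)⟩

lemma isLowerSet_filter_le (k : Fin (n + 1)) :
    IsLowerSet (({j | j ≤ k} : Finset (Fin (n + 1))) : Set (Fin (n + 1))) := by
  intro a b hba ha
  simp only [Finset.coe_filter, Finset.mem_univ, true_and, Set.mem_ofPred_eq] at ha ⊢
  exact hba.trans ha

lemma isLowerSet_filter_lt (k : Fin (n + 1)) :
    IsLowerSet (({j | j < k} : Finset (Fin (n + 1))) : Set (Fin (n + 1))) := by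
  intro a b hba ha
  simp only [Finset.coe_filter, Finset.mem_univ, true_and, Set.mem_ofPred_eq] at ha ⊢
  exact hba.trans_lt ha

lemma isLowerSet_filter_face_le {m : ℕ} (s : Fin (m + 1) ↪o Fin (n + 1)) (i : Fin (n + 1)) :
    IsLowerSet (({j | s j ≤ i} : Finset (Fin (m + 1))) : Set (Fin (m + 1))) := by
  intro a b hba ha
  simp only [Finset.coe_filter, Finset.mem_univ, true_and, Set.mem_ofPred_eq] at ha ⊢
  exact (s.monotone hba).trans ha

/-- A point of the simplex is determined by its sums over lower sets. -/
lemma Simplex.ext_of_sum_lowerSet {α β : Simplex n}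
    (h : ∀ J : Finset (Fin (n + 1)), IsLowerSet (J : Set (Fin (n + 1))) →
      ∑ j ∈ J, α j = ∑ j ∈ J, β j) : α = β := by
  refine stdSimplex.ext (funext fun k => ?_)
  have h1 := h _ (isLowerSet_filter_le k)
  have h2 := h _ (isLowerSet_filter_lt k)
  have hk : ({j | j ≤ k} : Finset (Fin (n + 1))) =
      insert k ({j | j < k} : Finset (Fin (n + 1))) := by
    ext j; simp [le_iff_eq_or_lt]
  rw [hk, Finset.sum_insert (by simp), Finset.sum_insert (by simp), h2] at h1
  exact add_right_cancel h1

lemma Simplex.sum_mem_Icc (α : Simplex n) (J : Finset (Fin (n + 1))) :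
    ∑ j ∈ J, α j ∈ Set.Icc (0 : ℝ) 1 := by
  refine ⟨Finset.sum_nonneg fun j _ => stdSimplex.zero_le α j, ?_⟩
  rw [← stdSimplex.sum_eq_one α]
  exact Finset.sum_le_sum_of_subset_of_nonneg (Finset.subset_univ J)
    fun j _ _ => stdSimplex.zero_le α j

lemma Simplex.sum_face {m : ℕ} (s : Fin (m + 1) ↪o Fin (n + 1)) (α : Simplex m)
    (i : Fin (n + 1)) :
    ∑ k with k ≤ i, Simplex.face m n s α k = ∑ j with s j ≤ i, α j := by
  simp only [Simplex.face_apply]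
  rw [Finset.sum_sigma']
  refine Finset.sum_bij' (fun x _ => x.2) (fun j _ => ⟨s j, j⟩) ?_ ?_ ?_ ?_ ?_ <;> aesop

variable {Ω : Type v}

/-- The first index `k` such that `ω ∈ G k`, and the last index if there is none. -/
def firstIndex (G : Fin (n + 1) → Set Ω) (ω : Ω) : Fin (n + 1) := by
  classical
  exact if h : ∃ k, ω ∈ G k then Fin.find (fun k => ω ∈ G k) h else Fin.last n

lemma firstIndex_le_iff {G : Fin (n + 1) → Set Ω} (hG : Monotone G) {ω : Ω}
    (hω : ω ∈ G (Fin.last n)) (k : Fin (n + 1)) : firstIndex G ω ≤ k ↔ ω ∈ G k := by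
  classical
  rw [firstIndex, dif_pos ⟨_, hω⟩]
  simp only [Fin.find_le_iff]
  exact ⟨fun ⟨m, hm, h⟩ => hG hm h, fun h => ⟨k, le_rfl, h⟩⟩

variable [MeasurableSpace Ω] {μ : Measure Ω}

lemma RVSimplex.ext_of_le {f g : RVSimplex μ n} (h : ∀ k, ∀ᵐ ω ∂μ, f ω ≤ k ↔ g ω ≤ k) : f = g := by
  refine RVSimplex.ext ?_
  filter_upwards [ae_all_iff.2 h] with ω hω
  exact le_antisymm ((hω _).2 le_rfl) ((hω _).1 le_rfl)

lemma measurable_firstIndex {G : Fin (n + 1) → Set Ω} (hG : ∀ k, MeasurableSet (G k)) :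
    Measurable (firstIndex G) := by
  classical
  refine measurable_of_Iic fun k => ?_
  have : firstIndex G ⁻¹' Set.Iic k =
      (⋃ m ≤ k, G m) ∪ ((⋃ m, G m)ᶜ ∩ {_ω | Fin.last n ≤ k}) := by
    ext ω
    simp only [firstIndex, Set.mem_preimage, Set.mem_Iic]
    split_ifs with h
    · simp [h]
    · push Not at h
      simp [h]
  rw [this]
  exact (MeasurableSet.biUnion (Set.to_countable _) fun m _ => hG m).union
    ((MeasurableSet.iUnion hG).compl.inter (MeasurableSet.const _))

variable [IsProbabilityMeasure μ]

lemma RVSimplex.sum_law_eq (f : RVSimplex μ n) (J : Finset (Fin (n + 1))) :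
    ∑ j ∈ J, RVSimplex.law μ n f j = μ.real {ω | f ω ∈ J} := by
  have h := measureReal_biUnion_finset (μ := μ) (s := J)
    (f := fun i : Fin (n + 1) => (f ⁻¹' {i} : Set Ω))
    (by
      intro i _ j _ hij
      exact Disjoint.preimage _ (by simpa using hij))
    (fun i _ => f.measurable (measurableSet_singleton i))
  have h' : (⋃ i ∈ J, (f ⁻¹' {i} : Set Ω)) = {ω | f ω ∈ J} := by
    ext ω; simp
  rw [h'] at h
  exact h.symm

lemma RVSimplex.dist_le_sum (f g : RVSimplex μ n) :
    dist f g ≤ ∑ k, μ.real {ω | ¬ (f ω ≤ k ↔ g ω ≤ k)} := by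
  rw [RVSimplex.dist_def]
  refine (measureReal_mono ?_ (measure_ne_top _ _)).trans
    (measureReal_biUnion_finset_le Finset.univ _)
  intro ω hω
  by_contra hc
  simp only [Finset.mem_univ, Set.iUnion_true, Set.mem_iUnion, Set.mem_ofPred_eq, not_exists,
    not_not] at hc
  exact hω (le_antisymm ((hc _).2 le_rfl) ((hc _).1 le_rfl))

/-- The measures of two events differ by at most the measure of their symmetric difference. -/
lemma dist_measureReal_le (p q : Ω → Prop) :
    dist (μ.real {ω | p ω}) (μ.real {ω | q ω}) ≤ μ.real {ω | ¬ (p ω ↔ q ω)} := by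
  have h : ∀ p q : Ω → Prop,
      μ.real {ω | p ω} - μ.real {ω | q ω} ≤ μ.real {ω | ¬ (p ω ↔ q ω)} := fun p q => by
    rw [sub_le_iff_le_add']
    refine (measureReal_mono fun ω hω => ?_).trans (measureReal_union_le _ _)
    by_cases hq : q ω
    · exact Or.inl hq
    · exact Or.inr fun hpq => hq (hpq.1 hω)
  rw [Real.dist_eq, abs_le]
  have h1 := h p q
  have h2 := h q p
  simp only [iff_comm (a := q _)] at h2
  constructor <;> linarith

end LowerSets

/-! ### The section and the rearrangement homotopy -/

namespace Exhaustion

variable {Ω : Type v} [MeasurableSpace Ω] {μ : Measure Ω}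
  (E : Exhaustion μ) {m n : ℕ}

/-- The random variable of law `α` that is increasing along the exhaustion. -/
def quantile (α : Simplex n) : RVSimplex μ n :=
  AEEqFun.mk (firstIndex fun k => {ω | E.time ω < ∑ j with j ≤ k, α j})
    (measurable_firstIndex fun _ =>
      measurableSet_lt E.measurable_time measurable_const).aestronglyMeasurable

lemma coe_quantile (α : Simplex n) : (E.quantile α : Ω → Fin (n + 1)) =ᵐ[μ]
    firstIndex fun k => {ω | E.time ω < ∑ j with j ≤ k, α j} :=
  AEEqFun.coeFn_mk _ _

/-- The random variable that agrees with `f` outside of `Ω_s`, and on `Ω_s` is the rearrangement of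
`f` that is increasing along the exhaustion. -/
def rearrange (s : ℝ) (f : RVSimplex μ n) : RVSimplex μ n :=
  AEEqFun.mk (firstIndex fun k => {ω | E.time ω < μ.real {ω | f ω ≤ k ∧ E.time ω < s} ∨
      (f ω ≤ k ∧ s ≤ E.time ω)})
    (measurable_firstIndex fun _ =>
      (measurableSet_lt E.measurable_time measurable_const).union
        ((f.measurable measurableSet_Iic).inter
          (measurableSet_le measurable_const E.measurable_time))).aestronglyMeasurable

lemma coe_rearrange (s : ℝ) (f : RVSimplex μ n) : (E.rearrange s f : Ω → Fin (n + 1)) =ᵐ[μ]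
    firstIndex fun k => {ω | E.time ω < μ.real {ω | f ω ≤ k ∧ E.time ω < s} ∨
      (f ω ≤ k ∧ s ≤ E.time ω)} :=
  AEEqFun.coeFn_mk _ _

variable [IsProbabilityMeasure μ]

lemma measureReal_not_time_lt_iff {a b : ℝ} (ha : a ∈ Set.Icc (0 : ℝ) 1)
    (hb : b ∈ Set.Icc (0 : ℝ) 1) :
    μ.real {ω | ¬ (E.time ω < a ↔ E.time ω < b)} ≤ dist a b := by
  wlog hab : a ≤ b generalizing a b
  · have := this hb ha (le_of_not_ge hab)
    simpa only [iff_comm, dist_comm] using this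
  have h : {ω | ¬ (E.time ω < a ↔ E.time ω < b)} = {ω | E.time ω < b} \ {ω | E.time ω < a} := by
    ext ω
    simp only [Set.mem_ofPred_eq, Set.mem_sdiff]
    constructor
    · intro h
      by_cases h' : E.time ω < a
      · exact absurd ⟨fun _ => h'.trans_le hab, fun _ => h'⟩ h
      · exact ⟨by_contra fun h'' => h ⟨fun h => absurd h h', fun h => absurd h h''⟩, h'⟩
    · exact fun h h' => h.2 (h'.2 h.1)
  have hsub : {ω | E.time ω < a} ⊆ {ω | E.time ω < b} := fun ω hω => hω.trans_le hab
  rw [h, measureReal_sdiff hsub (measurableSet_lt E.measurable_time measurable_const),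
    E.measureReal_time_lt ha, E.measureReal_time_lt hb, dist_comm, Real.dist_eq,
    abs_of_nonneg (sub_nonneg.2 hab)]

/-- The characterization of `quantile`, for all lower sets of values. -/
lemma quantile_mem_iff (α : Simplex n) {J : Finset (Fin (n + 1))}
    (hJ : IsLowerSet (J : Set (Fin (n + 1)))) :
    ∀ᵐ ω ∂μ, E.quantile α ω ∈ J ↔ E.time ω < ∑ j ∈ J, α j := by
  rcases eq_empty_or_eq_filter_le hJ with rfl | ⟨k, rfl⟩
  · refine Filter.Eventually.of_forall fun ω => ?_
    simpa using E.time_nonneg ω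
  · filter_upwards [E.coe_quantile α, E.ae_time_lt_one] with ω hω h1
    simp only [Finset.mem_filter, Finset.mem_univ, true_and]
    rw [hω, firstIndex_le_iff]
    · rfl
    · intro i j hij ω hω
      refine hω.trans_le (Finset.sum_le_sum_of_subset_of_nonneg (fun l hl => ?_)
        fun l _ _ => stdSimplex.zero_le α l)
      simp only [Finset.mem_filter, Finset.mem_univ, true_and] at hl ⊢
      exact hl.trans hij
    · simpa [Fin.le_last] using h1

lemma law_quantile (α : Simplex n) : RVSimplex.law μ n (E.quantile α) = α := by
  refine Simplex.ext_of_sum_lowerSet fun J hJ => ?_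
  rw [RVSimplex.sum_law_eq, ← E.measureReal_time_lt (α.sum_mem_Icc J)]
  refine measureReal_congr ?_
  filter_upwards [E.quantile_mem_iff α hJ] with ω hω
  exact propext hω

lemma quantile_le_iff (α : Simplex n) (k : Fin (n + 1)) :
    ∀ᵐ ω ∂μ, E.quantile α ω ≤ k ↔ E.time ω < ∑ j with j ≤ k, α j := by
  filter_upwards [E.quantile_mem_iff α (isLowerSet_filter_le k)] with ω hω
  rw [← hω]
  simp

lemma quantile_face (s : Fin (m + 1) ↪o Fin (n + 1)) (α : Simplex m) :
    E.quantile (Simplex.face m n s α) = RVSimplex.face m n s (E.quantile α) := by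
  refine RVSimplex.ext_of_le fun i => ?_
  filter_upwards [E.quantile_le_iff (Simplex.face m n s α) i, RVSimplex.coe_face s (E.quantile α),
    E.quantile_mem_iff α (isLowerSet_filter_face_le s i)] with ω h1 h2 h3
  rw [h1, h2, Simplex.sum_face, ← h3]
  simp

lemma continuous_quantile : Continuous (E.quantile : Simplex n → RVSimplex μ n) := by
  refine continuous_iff_continuousAt.2 fun β => tendsto_iff_dist_tendsto_zero.2 ?_
  have hcont : Continuous fun α : Simplex n =>
      ∑ k : Fin (n + 1), dist (∑ j with j ≤ k, α j) (∑ j with j ≤ k, β j) := by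
    refine continuous_finsetSum _ fun k _ => Continuous.dist ?_ continuous_const
    exact continuous_finsetSum _ fun j _ => (continuous_apply j).comp continuous_subtype_val
  have hlim := hcont.tendsto β
  simp only [dist_self, Finset.sum_const_zero] at hlim
  refine squeeze_zero (fun _ => dist_nonneg) (fun α => ?_) hlim
  refine (RVSimplex.dist_le_sum _ _).trans (Finset.sum_le_sum fun k _ => ?_)
  refine le_trans (le_of_eq (measureReal_congr ?_))
    (E.measureReal_not_time_lt_iff (α.sum_mem_Icc _) (β.sum_mem_Icc _))
  filter_upwards [E.quantile_le_iff α k, E.quantile_le_iff β k] with ω h1 h2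
  exact propext (not_congr (iff_congr h1 h2))

/-- The characterization of `rearrange`, for all lower sets of values. -/
lemma rearrange_mem_iff {s : ℝ} (hs : s ∈ Set.Icc (0 : ℝ) 1) (f : RVSimplex μ n)
    {J : Finset (Fin (n + 1))} (hJ : IsLowerSet (J : Set (Fin (n + 1)))) :
    ∀ᵐ ω ∂μ, E.rearrange s f ω ∈ J ↔
      E.time ω < μ.real {ω | f ω ∈ J ∧ E.time ω < s} ∨ (f ω ∈ J ∧ s ≤ E.time ω) := by
  rcases eq_empty_or_eq_filter_le hJ with rfl | ⟨k, rfl⟩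
  · refine Filter.Eventually.of_forall fun ω => ?_
    simpa using E.time_nonneg ω
  · filter_upwards [E.coe_rearrange s f] with ω hω
    simp only [Finset.mem_filter, Finset.mem_univ, true_and]
    rw [hω, firstIndex_le_iff]
    · rfl
    · rintro i j hij ω (h | h)
      · exact Or.inl (h.trans_le (measureReal_mono fun ω h => ⟨h.1.trans hij, h.2⟩))
      · exact Or.inr ⟨h.1.trans hij, h.2⟩
    · simp only [Set.mem_ofPred_eq, Fin.le_last, true_and, E.measureReal_time_lt hs]
      exact lt_or_ge _ _

lemma rearrange_le_iff {s : ℝ} (hs : s ∈ Set.Icc (0 : ℝ) 1) (f : RVSimplex μ n)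
    (k : Fin (n + 1)) :
    ∀ᵐ ω ∂μ, E.rearrange s f ω ≤ k ↔
      E.time ω < μ.real {ω | f ω ≤ k ∧ E.time ω < s} ∨ (f ω ≤ k ∧ s ≤ E.time ω) := by
  simpa using E.rearrange_mem_iff hs f (isLowerSet_filter_le k)

lemma measureReal_and_time_lt_mem_Icc {s : ℝ} (hs : s ∈ Set.Icc (0 : ℝ) 1) (p : Ω → Prop) :
    μ.real {ω | p ω ∧ E.time ω < s} ∈ Set.Icc 0 s :=
  ⟨measureReal_nonneg, (measureReal_mono fun _ h => h.2).trans_eq (E.measureReal_time_lt hs)⟩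

lemma law_rearrange {s : ℝ} (hs : s ∈ Set.Icc (0 : ℝ) 1) (f : RVSimplex μ n) :
    RVSimplex.law μ n (E.rearrange s f) = RVSimplex.law μ n f := by
  refine Simplex.ext_of_sum_lowerSet fun J hJ => ?_
  rw [RVSimplex.sum_law_eq, RVSimplex.sum_law_eq]
  have hmeas : MeasurableSet {ω | f ω ∈ J ∧ s ≤ E.time ω} :=
    (f.measurable J.measurableSet).inter (measurableSet_le measurable_const E.measurable_time)
  set b := μ.real {ω | f ω ∈ J ∧ E.time ω < s} with hb
  have hbs : b ∈ Set.Icc 0 s := E.measureReal_and_time_lt_mem_Icc hs _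
  calc μ.real {ω | E.rearrange s f ω ∈ J}
      = μ.real ({ω | E.time ω < b} ∪ {ω | f ω ∈ J ∧ s ≤ E.time ω}) := by
        refine measureReal_congr ?_
        filter_upwards [E.rearrange_mem_iff hs f hJ] with ω hω
        exact propext hω
    _ = b + μ.real {ω | f ω ∈ J ∧ s ≤ E.time ω} := by
        rw [measureReal_union _ hmeas, E.measureReal_time_lt ⟨hbs.1, hbs.2.trans hs.2⟩]
        exact Set.disjoint_left.2 fun ω h h' => (h.trans_le (hbs.2.trans h'.2)).false
    _ = μ.real {ω | f ω ∈ J} := by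
        rw [hb, ← measureReal_union _ hmeas]
        · congr 1
          ext ω
          simp only [Set.mem_union, Set.mem_ofPred_eq, ← and_or_left, lt_or_ge, and_true]
        · exact Set.disjoint_left.2 fun ω h h' => (h.2.trans_le h'.2).false

lemma rearrange_face {s : ℝ} (hs : s ∈ Set.Icc (0 : ℝ) 1) (φ : Fin (m + 1) ↪o Fin (n + 1))
    (f : RVSimplex μ m) :
    E.rearrange s (RVSimplex.face m n φ f) = RVSimplex.face m n φ (E.rearrange s f) := by
  refine RVSimplex.ext_of_le fun i => ?_
  have hreal : μ.real {ω | RVSimplex.face m n φ f ω ≤ i ∧ E.time ω < s} =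
      μ.real {ω | f ω ∈ ({j | φ j ≤ i} : Finset (Fin (m + 1))) ∧ E.time ω < s} := by
    refine measureReal_congr ?_
    filter_upwards [RVSimplex.coe_face φ f] with ω hω
    refine propext (and_congr_left fun _ => ?_)
    rw [hω]
    simp
  filter_upwards [E.rearrange_le_iff hs (RVSimplex.face m n φ f) i, RVSimplex.coe_face φ f,
    RVSimplex.coe_face φ (E.rearrange s f),
    E.rearrange_mem_iff hs f (isLowerSet_filter_face_le φ i)] with ω h1 h2 h3 h4
  rw [hreal, h2] at h1
  rw [h1, h3]
  simpa using h4.symm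

lemma rearrange_quantile {s : ℝ} (hs : s ∈ Set.Icc (0 : ℝ) 1) (α : Simplex n) :
    E.rearrange s (E.quantile α) = E.quantile α := by
  refine RVSimplex.ext_of_le fun k => ?_
  have hA := α.sum_mem_Icc {j | j ≤ k}
  have hreal : μ.real {ω | E.quantile α ω ≤ k ∧ E.time ω < s} =
      min (∑ j with j ≤ k, α j) s := by
    rw [← E.measureReal_time_lt ⟨le_min hA.1 hs.1, (min_le_right _ _).trans hs.2⟩]
    refine measureReal_congr ?_
    filter_upwards [E.quantile_le_iff α k] with ω hω
    refine propext ((and_congr_left fun _ => hω).trans lt_min_iff.symm)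
  filter_upwards [E.rearrange_le_iff hs (E.quantile α) k, E.quantile_le_iff α k] with ω h1 h2
  rw [h1, hreal, h2, lt_min_iff, ← and_or_left, and_iff_left (lt_or_ge _ _)]

lemma rearrange_one (f : RVSimplex μ n) :
    E.rearrange 1 f = E.quantile (RVSimplex.law μ n f) := by
  refine RVSimplex.ext_of_le fun k => ?_
  have hreal : μ.real {ω | f ω ≤ k ∧ E.time ω < 1} = ∑ j with j ≤ k, RVSimplex.law μ n f j := by
    rw [RVSimplex.sum_law_eq]
    refine measureReal_congr ?_
    filter_upwards [E.ae_time_lt_one] with ω hω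
    change (f ω ≤ k ∧ E.time ω < 1) = (f ω ∈ ({j | j ≤ k} : Finset (Fin (n + 1))))
    simp [hω]
  filter_upwards [E.rearrange_le_iff (s := 1) (by simp) f k, E.quantile_le_iff _ k,
    E.ae_time_lt_one] with ω h1 h2 h3
  rw [h1, h2, hreal]
  simp [h3]

lemma rearrange_zero (f : RVSimplex μ n) : E.rearrange 0 f = f := by
  refine RVSimplex.ext_of_le fun k => ?_
  have hb := E.measureReal_and_time_lt_mem_Icc (s := 0) (by simp) fun ω => f ω ≤ k
  filter_upwards [E.rearrange_le_iff (s := 0) (by simp) f k] with ω h1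
  rw [h1, le_antisymm hb.2 hb.1]
  simp [E.time_nonneg ω, (E.time_nonneg ω).not_gt]

/-- Joint Lipschitz continuity of `rearrange`. -/
lemma dist_rearrange_le {s t : ℝ} (hs : s ∈ Set.Icc (0 : ℝ) 1) (ht : t ∈ Set.Icc (0 : ℝ) 1)
    (f g : RVSimplex μ n) :
    dist (E.rearrange s f) (E.rearrange t g) ≤ (n + 1) * (2 * (dist s t + dist f g)) := by
  -- the events `{f ≤ k, E.time < s}`, or `{f ≤ k, s ≤ E.time}`, and their analogues for `g` and `t`
  -- only differ where `f ≠ g` or where `E.time` lies between `s` and `t`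
  have hdiff : μ.real ({ω | ¬ (E.time ω < s ↔ E.time ω < t)} ∪ {ω | f ω ≠ g ω}) ≤
      dist s t + dist f g :=
    (measureReal_union_le _ _).trans
      (add_le_add (E.measureReal_not_time_lt_iff hs ht) le_rfl)
  refine (RVSimplex.dist_le_sum _ _).trans ?_
  have hk : ∀ k ∈ Finset.univ, μ.real {ω | ¬ (E.rearrange s f ω ≤ k ↔ E.rearrange t g ω ≤ k)} ≤
      2 * (dist s t + dist f g) := fun k _ => by
    set a := μ.real {ω | f ω ≤ k ∧ E.time ω < s} with ha
    set b := μ.real {ω | g ω ≤ k ∧ E.time ω < t} with hb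
    have ha' : a ∈ Set.Icc (0 : ℝ) 1 := ⟨measureReal_nonneg, measureReal_le_one⟩
    have hb' : b ∈ Set.Icc (0 : ℝ) 1 := ⟨measureReal_nonneg, measureReal_le_one⟩
    have hab : dist a b ≤ dist s t + dist f g := by
      refine (dist_measureReal_le _ _).trans ((measureReal_mono fun ω hω => ?_).trans hdiff)
      by_contra hc
      simp only [Set.mem_union, Set.mem_ofPred_eq, not_or, not_not] at hc hω
      exact hω (by rw [hc.1, hc.2])
    calc _ ≤ μ.real ({ω | ¬ (E.time ω < a ↔ E.time ω < b)} ∪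
          ({ω | ¬ (E.time ω < s ↔ E.time ω < t)} ∪ {ω | f ω ≠ g ω})) := by
          refine ENNReal.toReal_mono (measure_ne_top _ _) (measure_mono_ae ?_)
          filter_upwards [E.rearrange_le_iff hs f k, E.rearrange_le_iff ht g k] with ω h1 h2 hω
          by_cases hA : E.time ω < a ↔ E.time ω < b
          · by_cases hS : E.time ω < s ↔ E.time ω < t
            · refine Or.inr (Or.inr fun hfg => hω ?_)
              rw [h1, h2, ← ha, ← hb, hA, hfg, ← not_lt (b := s), hS, not_lt]
            · exact Or.inr (Or.inl hS)
          · exact Or.inl hA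
      _ ≤ dist a b + (dist s t + dist f g) := (measureReal_union_le _ _).trans
          (add_le_add (E.measureReal_not_time_lt_iff ha' hb') hdiff)
      _ ≤ _ := by linarith
  refine (Finset.sum_le_card_nsmul _ _ _ hk).trans_eq ?_
  simp

/-- The section `σ_n` of the probability-law map. -/
def sectionMap (n : ℕ) : C(Simplex n, RVSimplex μ n) where
  toFun := E.quantile
  continuous_toFun := E.continuous_quantile

/-- The homotopy `H_n`: at time `r` the random variable is rearranged on `Ω_{1 - r}`. -/
def homotopy (n : ℕ) : ((E.sectionMap n).comp (RVSimplex.law μ n)).Homotopy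
    (ContinuousMap.id (RVSimplex μ n)) where
  toFun p := E.rearrange (1 - p.1) p.2
  continuous_toFun := by
    refine continuous_iff_continuousAt.2 fun q => tendsto_iff_dist_tendsto_zero.2 ?_
    have hcont : Continuous fun p : unitInterval × RVSimplex μ n =>
        (n + 1) * (2 * (dist (1 - p.1 : ℝ) (1 - q.1) + dist p.2 q.2)) := by fun_prop
    have hlim := hcont.tendsto q
    simp only [dist_self, add_zero, mul_zero] at hlim
    exact squeeze_zero (fun _ => dist_nonneg) (fun p => E.dist_rearrange_le
      (unitInterval.symm p.1).2 (unitInterval.symm q.1).2 _ _)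
      hlim
  map_zero_left f := by simpa using! E.rearrange_one f
  map_one_left f := by simpa using! E.rearrange_zero f

end Exhaustion

/-! ### Homotopies on realizations -/

section RealizationHomotopy

variable (F : PreSimplicialSet.{u}) {X : ℕ → Type v} {Y : ℕ → Type w}
  {dX : ∀ m n : ℕ, (Fin (m + 1) ↪o Fin (n + 1)) → X m → X n}
  {dY : ∀ m n : ℕ, (Fin (m + 1) ↪o Fin (n + 1)) → Y m → Y n}

lemma Realization.ind {p : Realization F X dX → Prop}
    (h : ∀ (n : ℕ) (x : F.simplices n) (a : X n), p (Realization.mk F dX x a))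
    (z : Realization F X dX) : p z := by
  obtain ⟨⟨⟨n, x⟩, a⟩, rfl⟩ := Quot.exists_rep z
  exact h n x a

variable [∀ n, TopologicalSpace (X n)] [∀ n, TopologicalSpace (Y n)]

/-- The map `(r, [α, a]) ↦ [α, Φ_n(r, a)]` induced by homotopies `Φ_n` that commute with the face
maps. It is obtained from a map to the space of paths, the unit interval being locally compact. -/
def Realization.homotopyMap (Φ : ∀ n, C(unitInterval × X n, Y n))
    (hΦ : ∀ (m n : ℕ) (s : Fin (m + 1) ↪o Fin (n + 1)) (r : unitInterval) (a : X m),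
      Φ n (r, dX m n s a) = dY m n s (Φ m (r, a))) :
    C(unitInterval × Realization F X dX, Realization F Y dY) :=
  let mkC (α : Σ n, F.simplices n) : C(X α.1 × unitInterval, Realization F Y dY) :=
    ⟨fun p => Realization.mk F dY α.2 (Φ α.1 (p.2, p.1)),
      continuous_quot_mk.comp
        ((continuous_sigmaMk (σ := fun β : (Σ n, F.simplices n) => Y β.1) (i := α)).comp
          ((Φ α.1).continuous.comp continuous_swap))⟩
  let path : C(Realization F X dX, C(unitInterval, Realization F Y dY)) :=
    { toFun := Quot.lift (fun x => (mkC x.1).curry x.2) (by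
        rintro _ _ ⟨m, n, s, α, a⟩
        ext r
        change Realization.mk F dY _ (Φ m (r, a)) = Realization.mk F dY α (Φ n (r, dX m n _ a))
        rw [hΦ]
        exact Quot.sound (FaceRel.glue (dX := dY) _ _ s α (Φ m (r, a))))
      continuous_toFun := continuous_quot_lift _
        (continuous_sigma fun α => (mkC α).curry.continuous) }
  path.uncurry.comp ⟨Prod.swap, continuous_swap⟩

end RealizationHomotopy

namespace Exhaustion

variable {Ω : Type v} [MeasurableSpace Ω] {μ : Measure Ω} [IsProbabilityMeasure μ]
  (E : Exhaustion μ) (F : PreSimplicialSet.{u})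

lemma homotopy_face (m n : ℕ) (s : Fin (m + 1) ↪o Fin (n + 1)) (r : unitInterval)
    (f : RVSimplex μ m) :
    E.homotopy n (r, RVSimplex.face m n s f) = RVSimplex.face m n s (E.homotopy m (r, f)) :=
  E.rearrange_face (unitInterval.symm r).2 s f

/-- The section `σ_F` of the probability-law map. -/
def sectionReal : C(GeomReal F, RVReal μ F) :=
  Realization.map F Simplex.face RVSimplex.face E.sectionMap fun _ _ s α => E.quantile_face s α

lemma lawReal_comp_sectionReal :
    (lawReal μ F).comp (E.sectionReal F) = ContinuousMap.id (GeomReal F) := by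
  ext z
  induction z using Realization.ind with
  | h n x α =>
    change Realization.mk F Simplex.face x (RVSimplex.law μ n (E.quantile α)) = _
    rw [E.law_quantile]
    rfl

/-- The homotopy `H_F` from `σ_F ∘ p_F` to the identity. -/
def homotopyReal : ((E.sectionReal F).comp (lawReal μ F)).Homotopy
    (ContinuousMap.id (RVReal μ F)) where
  toContinuousMap := Realization.homotopyMap F (fun n => (E.homotopy n).toContinuousMap)
    E.homotopy_face
  map_zero_left z := by
    induction z using Realization.ind with
    | h n x f => exact congrArg (Realization.mk F RVSimplex.face x) ((E.homotopy n).map_zero_left f)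
  map_one_left z := by
    induction z using Realization.ind with
    | h n x f => exact congrArg (Realization.mk F RVSimplex.face x) ((E.homotopy n).map_one_left f)

/-- The probability-law map as a homotopy equivalence. -/
def lawHomotopyEquiv : RVReal μ F ≃ₕ GeomReal F where
  toFun := lawReal μ F
  invFun := E.sectionReal F
  left_inv := ⟨E.homotopyReal F⟩
  right_inv := by rw [E.lawReal_comp_sectionReal]

end Exhaustion

end RandomizedSimplicial

end

universe u v

open RandomizedSimplicial in
theorem mainTheorem4 {Ω : Type v} [MeasurableSpace Ω] (μ : Measure Ω) [IsProbabilityMeasure μ]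
    (hμ : Atomless μ) :
    -- the probability-law map is a homotopy equivalence, and `𝕃(F)` has CW homotopy type
    (∀ F : PreSimplicialSet.{u},
      (∃ e : RVReal μ F ≃ₕ GeomReal F, e.toFun = lawReal μ F) ∧
      HasCWHomotopyType.{u} (RVReal μ F)) ∧
    -- an explicit homotopy inverse and homotopy, for every choice of an exhaustion map
    Nonempty (Exhaustion μ) ∧
    ∀ E : Exhaustion μ,
      ∃ (σ : ∀ n, C(Simplex n, RVSimplex μ n))
        (H : ∀ n, ((σ n).comp (RVSimplex.law μ n)).Homotopy (ContinuousMap.id (RVSimplex μ n))),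
        -- `σ_n(α)` takes the value `k` on `Ω_{α_0 + ⋯ + α_k} \ Ω_{α_0 + ⋯ + α_{k-1}}`
        (∀ (n : ℕ) (α : Simplex n) (k : Fin (n + 1)),
          ∀ᵐ t ∂μ, t ∈ E.set (∑ j with j ≤ k, α j) \ E.set (∑ j with j < k, α j) →
            σ n α t = k) ∧
        -- `σ_n` is a section of `p_n` and commutes with the face maps
        (∀ n, (RVSimplex.law μ n).comp (σ n) = ContinuousMap.id (Simplex n)) ∧
        (∀ (m n : ℕ) (s : Fin (m + 1) ↪o Fin (n + 1)) (α : Simplex m),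
          σ n (Simplex.face m n s α) = RVSimplex.face m n s (σ m α)) ∧
        -- `H_n` commutes with the face maps, preserves laws and fixes the image of `σ_n`
        (∀ (m n : ℕ) (s : Fin (m + 1) ↪o Fin (n + 1)) (r : unitInterval) (f : RVSimplex μ m),
          H n (r, RVSimplex.face m n s f) = RVSimplex.face m n s (H m (r, f))) ∧
        (∀ (n : ℕ) (r : unitInterval) (f : RVSimplex μ n),
          RVSimplex.law μ n (H n (r, f)) = RVSimplex.law μ n f) ∧
        (∀ (n : ℕ) (r : unitInterval) (α : Simplex n), H n (r, σ n α) = σ n α) ∧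
        -- the `σ_n` and `H_n` induce a homotopy inverse of the probability-law map
        ∀ F : PreSimplicialSet.{u},
          ∃ (σF : C(GeomReal F, RVReal μ F))
            (HF : (σF.comp (lawReal μ F)).Homotopy (ContinuousMap.id (RVReal μ F))),
            (∀ (n : ℕ) (x : F.simplices n) (α : Simplex n),
              σF (Realization.mk F Simplex.face x α) =
                Realization.mk F RVSimplex.face x (σ n α)) ∧
            (∀ (n : ℕ) (r : unitInterval) (x : F.simplices n) (f : RVSimplex μ n),
              HF (r, Realization.mk F RVSimplex.face x f) =
                Realization.mk F RVSimplex.face x (H n (r, f))) ∧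
            (lawReal μ F).comp σF = ContinuousMap.id (GeomReal F) := by
  refine ⟨fun F => ?_, nonempty_exhaustion hμ, fun E => ⟨E.sectionMap, E.homotopy, ?_, ?_, ?_, ?_,
    ?_, ?_, fun F => ⟨E.sectionReal F, E.homotopyReal F, fun _ _ _ => rfl, fun _ _ _ _ => rfl,
      E.lawReal_comp_sectionReal F⟩⟩⟩
  · obtain ⟨E⟩ := nonempty_exhaustion hμ
    exact ⟨⟨E.lawHomotopyEquiv F, rfl⟩, GeomReal F, inferInstance, inferInstance,
      ⟨geomRealCWComplex F⟩, ⟨E.lawHomotopyEquiv F⟩⟩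
  · intro n α k
    filter_upwards [E.setOf_time_lt_ae_eq (α.sum_mem_Icc {j | j ≤ k}),
      E.setOf_time_lt_ae_eq (α.sum_mem_Icc {j | j < k}), E.quantile_le_iff α k,
      E.quantile_mem_iff α (isLowerSet_filter_lt k)] with ω h1 h2 h3 h4 hω
    refine le_antisymm (h3.2 (h1.mpr hω.1)) (le_of_not_gt fun h => ?_)
    have h5 := h4.1 (by simpa using! h)
    exact hω.2 (h2.mp h5)
  · exact fun n => ContinuousMap.ext E.law_quantile
  · exact fun m n s α => E.quantile_face s α
  · exact E.homotopy_face
  · exact fun n r f => E.law_rearrange (unitInterval.symm r).2 f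
  · exact fun n r α => E.rearrange_quantile (unitInterval.symm r).2 α
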